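/- Let $T$ be a directed tree model on $[n]=\{1,\dots,n\}$, i.e. a directed acyclic graph on $[n]$ whose underlying undirected graph is a tree (a node may have several parents). For a node $i$, let $\mathrm{pa}(i)$ be its set of parents and $\mathrm{nd}(i)$ its set of non-descendants, i.e. of the nodes $j\ne i$ that cannot be reached from $i$ by a directed path. The imposed relations of $T$ are $i\perp\!\!\!\perp \mathrm{nd}(i)\mid \mathrm{pa}(i)$, $i\in[n]$. Let $\Sigma=\mathbb{C}^{\binom{n+1}{2}}$ be the affine space of symmetric complex $n\times n$ matrices $(\sigma_{ij})$, and $\hat\Sigma\subset\Sigma$ the subspace of matrices with ones along the diagonal; $\mathbb{C}[\Sigma]$ is the polynomial ring in the $\sigma_{ij}$, $i\le j$, and $\mathbb{C}[\hat\Sigma]$ the polynomial ring in the $\sigma_{ij}$, $i<j$. Let $I_T\subset\mathbb{C}[\Sigma]$ be the ideal generated by the minors $|\sigma_{iK,jK}|$ (rows $\{i\}\cup K$, columns $\{j\}\cup K$) with $i\in[n]$, $K=\mathrm{pa}(i)$, $j\in \mathrm{nd}(i)\setminus \mathrm{pa}(i)$, and let $\hat I_T\subset\mathbb{C}[\hat\Sigma]$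 be the ideal generated by the same minors after setting $\sigma_{ii}=1$ for all $i$. Let $\mathrm{loc}(T)\subset\Sigma$ be the set of covariance matrices of the real, possibly degenerate, Gaussian random vectors $(X_1,\dots,X_n)$ such that $X_i$ is conditionally independent of $X_{\mathrm{nd}(i)}$ given $X_{\mathrm{pa}(i)}$ for all $i$. Let $[\cdot]_Z$ denote the Zariski closure in the complex affine space, and put $\hat X_T=[\mathrm{loc}(T)\cap\hat\Sigma]_Z$. Let $\hat\theta_0=\prod_{A\subset[n]}|\hat\Sigma_{AA}|\in\mathbb{C}[\hat\Sigma]$ be the product of all principal minors of the generic symmetric matrix with unit diagonal. Then: 1. $\hat I_T$ is a prime ideal of $\mathbb{C}[\hat\Sigma]$. 2. $\hat I_T$ is the ideal of all polynomials in $\mathbb{C}[\hat\Sigma]$ that vanish on $\hat X_T=[\mathrm{loc}(T)\cap\hat\Sigma]_Z$. In particular no saturation is needed: the contraction to $\mathbb{C}[\hat\Sigma]$ of the extension of $\hat I_T$ to $\mathbb{C}[\hat\Sigma][1/\hat\theta_0]$ is $\hat I_T$ itself. 3. $V(I_T)\cap\hat\Sigma=[\mathrm{loc}(T)\cap\hat\Sigma]_Z$.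 4. $\hat X_T$ is smooth at every point, i.e. its coordinate ring is a smooth $\mathbb{C}$-algebra. -/

import Mathlib

/-- A directed acyclic graph on the node set `Fin n`. No topological sorting of the labels
is required. -/
structure DAGModel (n : ℕ) where
  /-- `Edge i j` means that there is an edge `i → j`. -/
  Edge : Fin n → Fin n → Prop
  acyclic : ∀ i, ¬ Relation.TransGen Edge i i

namespace DAGModel

open MeasureTheory ProbabilityTheory MvPolynomial

/-! ### Combinatorics -/

section Combinatorics

variable {n : ℕ} (G : DAGModel n)

open Classical in
/-- The parents of a node. -/
noncomputable def pa (i : Fin n) : Finset (Fin n) :=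
  Finset.univ.filter fun j => G.Edge j i

open Classical in
/-- The non-descendants of a node (the node itself is not one of them). -/
noncomputable def nd (i : Fin n) : Finset (Fin n) :=
  Finset.univ.filter fun j => j ≠ i ∧ ¬ Relation.TransGen G.Edge i j

/-- The underlying undirected graph. -/
def skeleton : SimpleGraph (Fin n) := SimpleGraph.fromRel G.Edge

/-- A directed tree model: the underlying undirected graph is a tree (a node may have
several parents). -/
def IsDirectedTree : Prop := G.skeleton.IsTree

end Combinatorics

/-! ### Distributions -/

/-- `X_I ⫫ X_J | X_K` for the coordinate vector `X` under the law `P`. -/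
def CondIndepCoord {n : ℕ} (P : Measure (Fin n → ℝ)) [IsFiniteMeasure P]
    (I J K : Finset (Fin n)) : Prop :=
  CondIndepFun
    (MeasurableSpace.comap (Finset.restrict (π := fun _ : Fin n => ℝ) K) inferInstance)
    (Finset.measurable_restrict (X := fun _ : Fin n => ℝ) K).comap_le
    (Finset.restrict (π := fun _ : Fin n => ℝ) I) (Finset.restrict (π := fun _ : Fin n => ℝ) J) P

/-- The `G`-compatible laws: those with the imposed (local Markov) relations
`i ⫫ nd(i) | pa(i)` for every node `i`. -/
def Loc {n : ℕ} (G : DAGModel n) : Set (ProbabilityMeasure (Fin n → ℝ)) :=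
  {P | ∀ i, CondIndepCoord (P : Measure (Fin n → ℝ)) {i} (G.nd i) (G.pa i)}

/-- The real Gaussian laws, possibly degenerate. -/
def gaussians (n : ℕ) : Set (ProbabilityMeasure (Fin n → ℝ)) :=
  {P | IsGaussian (P : Measure (Fin n → ℝ))}

/-! ### Covariance matrices -/

/-- The affine space of symmetric complex `n × n` matrices, with one coordinate for each
unordered pair of indices. -/
abbrev Sig (n : ℕ) : Type := Sym2 (Fin n) → ℂ

/-- The covariance matrix of a law, as a point of `Sig n`. -/
noncomputable def cov {n : ℕ} (P : ProbabilityMeasure (Fin n → ℝ)) : Sig n :=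
  Sym2.lift ⟨fun i j =>
    ((covariance (fun x : Fin n → ℝ => x i) (fun x => x j) (P : Measure (Fin n → ℝ)) : ℝ) : ℂ),
    fun _ _ => congrArg _ (covariance_comm _ _)⟩

/-- `loc(G)`: the covariance matrices of the `G`-compatible Gaussian laws. -/
def loc {n : ℕ} (G : DAGModel n) : Set (Sig n) := cov '' (G.Loc ∩ gaussians n)

/-- The matrices with ones along the diagonal. -/
def sigHat (n : ℕ) : Set (Sig n) := {x | ∀ i, x s(i, i) = 1}

/-- Zariski closure in a complex affine space. -/
def zariskiClosure {ι : Type} (S : Set (ι → ℂ)) : Set (ι → ℂ) :=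
  zeroLocus ℂ (vanishingIdeal ℂ S)

/-- The variety of `G` in the space of matrices with unit diagonal: the Zariski closure of
`loc(G) ∩ sigHat`. -/
def XHat {n : ℕ} (G : DAGModel n) : Set (Sig n) := zariskiClosure (G.loc ∩ sigHat n)

/-! ### Ideals -/

/-- The coordinate ring of `Sig n`. -/
abbrev PolySig (n : ℕ) : Type := MvPolynomial (Sym2 (Fin n)) ℂ

/-- Unordered pairs of distinct indices. -/
abbrev OffDiag (n : ℕ) : Type := {e : Sym2 (Fin n) // ¬ e.IsDiag}

/-- The coordinate ring of the space of symmetric matrices with unit diagonal. -/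
abbrev PolySigHat (n : ℕ) : Type := MvPolynomial (OffDiag n) ℂ

/-- The generic symmetric matrix. -/
noncomputable def genericMatrix (n : ℕ) : Matrix (Fin n) (Fin n) (PolySig n) :=
  Matrix.of fun i j => X s(i, j)

open Classical in
/-- The generic symmetric matrix with unit diagonal. -/
noncomputable def genericMatrixHat (n : ℕ) : Matrix (Fin n) (Fin n) (PolySigHat n) :=
  Matrix.of fun i j => if h : (s(i, j) : Sym2 (Fin n)).IsDiag then 1 else X ⟨s(i, j), h⟩

/-- The minor `|M_{iK,jK}|`, with rows `i, K` and columns `j, K`. -/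
def ciMinor {n : ℕ} {R : Type} [CommRing R] (M : Matrix (Fin n) (Fin n) R)
    (i j : Fin n) (K : Finset (Fin n)) : R :=
  (M.submatrix (fun a : Option K => a.elim i fun k => k.1)
    (fun a : Option K => a.elim j fun k => k.1)).det

/-- The ideal generated by the minors of the imposed relations `i ⫫ j | pa(i)`, `j ∈ nd(i)`.
(For `j ∈ pa(i)` the minor has a repeated column, so it is zero.) -/
def imposedIdealOf {n : ℕ} (G : DAGModel n) {R : Type} [CommRing R]
    (M : Matrix (Fin n) (Fin n) R) : Ideal R :=
  Ideal.span {f | ∃ i, ∃ j ∈ G.nd i, f = ciMinor M i j (G.pa i)}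

/-- The ideal of imposed relations in the coordinate ring of symmetric matrices. -/
noncomputable def imposedIdeal {n : ℕ} (G : DAGModel n) : Ideal (PolySig n) :=
  G.imposedIdealOf (genericMatrix n)

/-- The ideal of imposed relations in the coordinate ring of symmetric matrices with unit
diagonal. -/
noncomputable def imposedIdealHat {n : ℕ} (G : DAGModel n) : Ideal (PolySigHat n) :=
  G.imposedIdealOf (genericMatrixHat n)

/-- The product of all principal minors of the generic symmetric matrix with unit diagonal. -/
noncomputable def thetaHat (n : ℕ) : PolySigHat n :=
  ∏ A : Finset (Fin n),
    ((genericMatrixHat n).submatrix (fun a : A => a.1) (fun a : A => a.1)).det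

/-- The saturation of `I` at `θ`: the contraction of its extension to the localization
at the powers of `θ`. -/
noncomputable def saturation {R : Type} [CommRing R] (I : Ideal R) (θ : R) : Ideal R :=
  (I.map (algebraMap R (Localization.Away θ))).comap (algebraMap R (Localization.Away θ))

/-- The coordinates of a unit-diagonal symmetric matrix. -/
def offDiagCoord {n : ℕ} (x : Sig n) : OffDiag n → ℂ := fun e => x e.1

/-- The ideal, in the coordinate ring of the unit-diagonal symmetric matrices, of a set of
unit-diagonal matrices. -/
noncomputable def idealHat {n : ℕ} (S : Set (Sig n)) : Ideal (PolySigHat n) :=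
  vanishingIdeal ℂ (offDiagCoord '' S)

/-- An affine algebraic set is smooth (at every point) when its coordinate ring is a smooth
`ℂ`-algebra. -/
def IsSmoothVariety {ι : Type} (S : Set (ι → ℂ)) : Prop :=
  Algebra.Smooth ℂ (MvPolynomial ι ℂ ⧸ vanishingIdeal ℂ S)

end DAGModel

/-! In a tree, two distinct parents of a node have no common ancestor
(`IsDirectedTree.eq_of_haveCommonAncestor`). In a linear structural model with unit variances they
are therefore uncorrelated, the conditioning block of every imposed minor is an identity matrix, and
the minor is the regression equation `M i j = ∑ k ∈ pa i, M i k * M k j` (`ciMinor_eq`). These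
equations determine the whole matrix from its entries on the edges, through the polynomials `trek`.

The core is `IsDirectedTree.eq_trek`, valid over every commutative ring: a symmetric unit-diagonal
matrix satisfying the equations is `trek` of itself. Over the quotient by the ideal it gives
`imposedIdealHat = ker paramHat` (hence primeness); over ℂ, the points of `V(I_T) ∩ sigHat`; over ℝ,
the covariances of compatible Gaussian laws.

Conversely, small real edge weights give positive semidefinite trek matrices, hence compatible
Gaussian laws. Such weights are Zariski dense in the edge space, so the closure of `loc ∩ sigHat` is
the whole image of the parametrization. That image is a graph over the edge space, so its coordinate
ring is a polynomial ring and is smooth. Finally, no principal minor vanishes at the identity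
matrix, which lies in the model, so saturating the prime ideal changes nothing. -/

namespace DAGModel

/-! ### Trek polynomials and the combinatorics of directed trees -/

section Trek

variable {n : ℕ} (G : DAGModel n)

theorem mem_pa {i k : Fin n} : k ∈ G.pa i ↔ G.Edge k i := by
  simp [pa]

theorem mem_nd {i j : Fin n} : j ∈ G.nd i ↔ j ≠ i ∧ ¬ Relation.TransGen G.Edge i j := by
  simp [nd]

theorem pa_subset_nd (i : Fin n) : G.pa i ⊆ G.nd i := by
  intro k hk
  rw [mem_pa] at hk
  rw [mem_nd]
  refine ⟨?_, fun h => G.acyclic i (h.tail hk)⟩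
  rintro rfl
  exact G.acyclic k (.single hk)

open Classical in
/-- The position of a node in a topological ordering. -/
noncomputable def topo (i : Fin n) : ℕ :=
  -- The ancestor count gives the order; the label, recoverable modulo `n`, breaks ties.
  (Finset.univ.filter fun j => Relation.TransGen G.Edge j i).card * n + i

theorem topo_lt_of_edge {k i : Fin n} (h : G.Edge k i) : G.topo k < G.topo i := by
  classical
  have hlt : (Finset.univ.filter fun j => Relation.TransGen G.Edge j k).card <
      (Finset.univ.filter fun j => Relation.TransGen G.Edge j i).card := by
    apply Finset.card_lt_card
    rw [Finset.ssubset_iff_of_subset]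
    · exact ⟨k, by simpa using .single h, by simpa using G.acyclic k⟩
    · intro j hj
      simp only [Finset.mem_filter, Finset.mem_univ, true_and] at hj ⊢
      exact hj.tail h
  have h1 : ((Finset.univ.filter fun j => Relation.TransGen G.Edge j k).card + 1) * n ≤
      (Finset.univ.filter fun j => Relation.TransGen G.Edge j i).card * n :=
    Nat.mul_le_mul_right n hlt
  have := k.isLt
  unfold topo
  lia

theorem topo_injective : Function.Injective G.topo := by
  intro i j h
  unfold topo at h
  have := congrArg (· % n) h
  simp only [Nat.mul_add_mod', Nat.mod_eq_of_lt i.isLt, Nat.mod_eq_of_lt j.isLt] at this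
  exact Fin.ext this

theorem topo_lt_of_transGen {k i : Fin n} (h : Relation.TransGen G.Edge k i) :
    G.topo k < G.topo i := by
  induction h with
  | single h => exact G.topo_lt_of_edge h
  | tail _ h ih => exact ih.trans (G.topo_lt_of_edge h)

theorem topo_lt_of_mem_pa {k i : Fin n} (h : k ∈ G.pa i) : G.topo k < G.topo i :=
  G.topo_lt_of_edge (G.mem_pa.1 h)

theorem mem_nd_of_topo_lt {i j : Fin n} (h : G.topo j < G.topo i) : j ∈ G.nd i := by
  rw [mem_nd]
  refine ⟨?_, fun h' => lt_asymm h (G.topo_lt_of_transGen h')⟩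
  rintro rfl
  exact lt_irrefl _ h

variable {R : Type*} [CommRing R]

/-- The correlation matrix of the linear structural equation model on `G` with edge weights `w`
and unit variances, provided that the parents of each node are uncorrelated. -/
noncomputable def trek (w : Fin n → Fin n → R) (i j : Fin n) : R :=
  if i = j then 1
  else if G.topo j < G.topo i then ∑ k : {k // k ∈ G.pa i}, w k i * trek w k j
  else ∑ k : {k // k ∈ G.pa j}, w k j * trek w i k
termination_by G.topo i + G.topo j
decreasing_by
  · have := G.topo_lt_of_mem_pa k.2
    lia
  · have := G.topo_lt_of_mem_pa k.2
    lia

variable (w : Fin n → Fin n → R)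

@[simp]
theorem trek_self (i : Fin n) : G.trek w i i = 1 := by
  rw [trek, if_pos rfl]

theorem trek_of_topo_lt {i j : Fin n} (h : G.topo j < G.topo i) :
    G.trek w i j = ∑ k ∈ G.pa i, w k i * G.trek w k j := by
  have hne : i ≠ j := by
    rintro rfl
    exact lt_irrefl _ h
  rw [trek, if_neg hne, if_pos h]
  exact Finset.sum_coe_sort (G.pa i) fun k => w k i * G.trek w k j

theorem trek_of_topo_lt' {i j : Fin n} (h : G.topo i < G.topo j) :
    G.trek w i j = ∑ k ∈ G.pa j, w k j * G.trek w i k := by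
  have hne : i ≠ j := by
    rintro rfl
    exact lt_irrefl _ h
  rw [trek, if_neg hne, if_neg h.not_gt]
  exact Finset.sum_coe_sort (G.pa j) fun k => w k j * G.trek w i k

theorem topo_induction {P : Fin n → Fin n → Prop} (self : ∀ i, P i i)
    (gt : ∀ i j, G.topo j < G.topo i → (∀ k ∈ G.pa i, P k j) → P i j)
    (lt : ∀ i j, G.topo i < G.topo j → (∀ k ∈ G.pa j, P i k) → P i j) (i j : Fin n) : P i j := by
  induction h : G.topo i + G.topo j using Nat.strong_induction_on generalizing i j with
  | _ N ih =>
    subst h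
    rcases lt_trichotomy (G.topo j) (G.topo i) with hji | hji | hji
    · refine gt i j hji fun k hk => ih _ ?_ k j rfl
      have := G.topo_lt_of_mem_pa hk
      lia
    · rw [G.topo_injective hji]
      exact self i
    · refine lt i j hji fun k hk => ih _ ?_ i k rfl
      have := G.topo_lt_of_mem_pa hk
      lia

theorem trek_comm (i j : Fin n) : G.trek w i j = G.trek w j i := by
  induction i, j using G.topo_induction with
  | self i => rfl
  | gt i j h ih =>
    rw [G.trek_of_topo_lt w h, G.trek_of_topo_lt' w h]
    exact Finset.sum_congr rfl fun k hk => by rw [ih k hk]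
  | lt i j h ih =>
    rw [G.trek_of_topo_lt w h, G.trek_of_topo_lt' w h]
    exact Finset.sum_congr rfl fun k hk => by rw [ih k hk]

/-- The recursion reads weights only on edges, so agreement there suffices. -/
theorem map_trek {S : Type*} [CommRing S] (f : R →+* S) {w' : Fin n → Fin n → S}
    (h : ∀ k i, G.Edge k i → f (w k i) = w' k i) (i j : Fin n) :
    f (G.trek w i j) = G.trek w' i j := by
  induction i, j using G.topo_induction with
  | self i => simp
  | gt i j hij ih =>
    rw [G.trek_of_topo_lt w hij, G.trek_of_topo_lt w' hij, map_sum]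
    exact Finset.sum_congr rfl fun k hk => by rw [map_mul, ih k hk, h k i (G.mem_pa.1 hk)]
  | lt i j hij ih =>
    rw [G.trek_of_topo_lt' w hij, G.trek_of_topo_lt' w' hij, map_sum]
    exact Finset.sum_congr rfl fun k hk => by rw [map_mul, ih k hk, h k j (G.mem_pa.1 hk)]

/-- Two nodes with a common ancestor (every node being an ancestor of itself here). -/
def HaveCommonAncestor (i j : Fin n) : Prop :=
  ∃ a, Relation.ReflTransGen G.Edge a i ∧ Relation.ReflTransGen G.Edge a j

theorem trek_eq_zero {i j : Fin n} (h : ¬ G.HaveCommonAncestor i j) : G.trek w i j = 0 := by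
  induction i, j using G.topo_induction with
  | self i => exact absurd ⟨i, .refl, .refl⟩ h
  | gt i j hij ih =>
    rw [G.trek_of_topo_lt w hij]
    refine Finset.sum_eq_zero fun k hk => ?_
    rw [ih k hk, mul_zero]
    rintro ⟨a, h1, h2⟩
    exact h ⟨a, h1.tail (G.mem_pa.1 hk), h2⟩
  | lt i j hij ih =>
    rw [G.trek_of_topo_lt' w hij]
    refine Finset.sum_eq_zero fun k hk => ?_
    rw [ih k hk, mul_zero]
    rintro ⟨a, h1, h2⟩
    exact h ⟨a, h1, h2.tail (G.mem_pa.1 hk)⟩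

variable {G}

theorem skeleton_adj_of_edge {i j : Fin n} (h : G.Edge i j) : G.skeleton.Adj i j := by
  rw [skeleton, SimpleGraph.fromRel_adj]
  refine ⟨?_, .inl h⟩
  rintro rfl
  exact G.acyclic i (.single h)

theorem exists_walk_of_reflTransGen {a b : Fin n} (h : Relation.ReflTransGen G.Edge a b) :
    ∃ p : G.skeleton.Walk a b, ∀ v ∈ p.support, Relation.ReflTransGen G.Edge v b := by
  induction h with
  | refl => exact ⟨.nil, by simp [Relation.ReflTransGen.refl]⟩
  | @tail b c _ hbc ih =>
    obtain ⟨p, hp⟩ := ih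
    refine ⟨p.concat (skeleton_adj_of_edge hbc), fun v hv => ?_⟩
    rw [SimpleGraph.Walk.support_concat, List.mem_append, List.mem_singleton] at hv
    rcases hv with hv | rfl
    · exact (hp v hv).tail hbc
    · exact .refl

/-- Directed paths from the common ancestor through `k` and through `l` yield two paths to `i` in
the skeleton. Uniqueness of paths in a tree identifies them, and with them their penultimate
vertices. -/
theorem IsDirectedTree.eq_of_haveCommonAncestor (hT : G.IsDirectedTree) {i k l : Fin n}
    (hk : G.Edge k i) (hl : G.Edge l i) (h : G.HaveCommonAncestor k l) : k = l := by
  classical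
  obtain ⟨a, hak, hal⟩ := h
  have key : ∀ {b : Fin n} (_ : G.Edge b i), Relation.ReflTransGen G.Edge a b →
      ∃ p : G.skeleton.Walk a i, p.IsPath ∧ p.penultimate = b := by
    intro b hb hab
    obtain ⟨p, hp⟩ := exists_walk_of_reflTransGen hab
    refine ⟨p.bypass.concat (skeleton_adj_of_edge hb), ?_, by simp⟩
    refine (SimpleGraph.Walk.bypass_isPath p).concat ?_ _
    -- If `i` were already on the path it would be an ancestor of `b`, and `b → i` would close a
    -- directed cycle.
    intro hi
    have := hp i (SimpleGraph.Walk.support_bypass_subset_support p hi)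
    exact G.acyclic i (Relation.TransGen.tail' this hb)
  obtain ⟨p, hp, hpk⟩ := key hk hak
  obtain ⟨q, hq, hql⟩ := key hl hal
  have : p = q :=
    congrArg Subtype.val ((hT.isAcyclic.subsingleton_path a i).elim ⟨p, hp⟩ ⟨q, hq⟩)
  rw [← hpk, ← hql, this]

/-- Distinct parents of a node are uncorrelated, with unit variances. -/
def OrthonormalParents (G : DAGModel n) (M : Fin n → Fin n → R) (i : Fin n) : Prop :=
  ∀ k ∈ G.pa i, ∀ l ∈ G.pa i, M k l = if k = l then 1 else 0

theorem IsDirectedTree.orthonormalParents_trek (hT : G.IsDirectedTree) (i : Fin n) :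
    G.OrthonormalParents (G.trek w) i := by
  intro k hk l hl
  split_ifs with h
  · rw [h, trek_self]
  · refine G.trek_eq_zero w fun h' => h ?_
    exact hT.eq_of_haveCommonAncestor (G.mem_pa.1 hk) (G.mem_pa.1 hl) h'

/-- A non-descendant may come after `i` in the topological order. In that case `j` is expanded over
its own parents, which are again non-descendants of `i`, and the two sums are exchanged. -/
theorem trek_of_mem_nd {i j : Fin n} (h : j ∈ G.nd i) :
    G.trek w i j = ∑ k ∈ G.pa i, w k i * G.trek w k j := by
  induction hN : G.topo j using Nat.strong_induction_on generalizing j with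
  | _ N ih =>
    subst hN
    rcases lt_trichotomy (G.topo j) (G.topo i) with hji | hji | hji
    · exact G.trek_of_topo_lt w hji
    · exact absurd (G.topo_injective hji) (G.mem_nd.1 h).1
    · have hnd : ∀ k ∈ G.pa j, k ∈ G.nd i := by
        intro k hk
        rw [mem_pa] at hk
        rw [mem_nd] at h ⊢
        refine ⟨?_, fun h' => h.2 (h'.tail hk)⟩
        rintro rfl
        exact h.2 (.single hk)
      rw [G.trek_of_topo_lt' w hji]
      calc ∑ k ∈ G.pa j, w k j * G.trek w i k
          = ∑ k ∈ G.pa j, ∑ l ∈ G.pa i, w l i * (w k j * G.trek w l k) := by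
            refine Finset.sum_congr rfl fun k hk => ?_
            rw [ih _ (G.topo_lt_of_mem_pa hk) (hnd k hk) rfl, Finset.mul_sum]
            exact Finset.sum_congr rfl fun l _ => by ring
        _ = ∑ l ∈ G.pa i, w l i * G.trek w l j := by
            rw [Finset.sum_comm]
            refine Finset.sum_congr rfl fun l hl => ?_
            rw [G.trek_of_topo_lt' w ((G.topo_lt_of_mem_pa hl).trans hji), Finset.mul_sum]

/-- Orthonormality of the parents collapses the recursion to one term, so the weights can be read
off the matrix. -/
theorem IsDirectedTree.trek_of_edge (hT : G.IsDirectedTree) {k i : Fin n} (h : G.Edge k i) :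
    G.trek w k i = w k i := by
  rw [G.trek_of_topo_lt' w (G.topo_lt_of_edge h), Finset.sum_eq_single k]
  · simp
  · intro l hl hne
    rw [hT.orthonormalParents_trek w i k (G.mem_pa.2 h) l hl, if_neg hne.symm, mul_zero]
  · exact fun h' => absurd (G.mem_pa.2 h) h'

/-- The matrix `M` satisfies the regression equation of each node on its parents, as long as
these are uncorrelated. -/
def LocallyRecursive (G : DAGModel n) (M : Fin n → Fin n → R) : Prop :=
  ∀ i, G.OrthonormalParents M i → ∀ j ∈ G.nd i, M i j = ∑ k ∈ G.pa i, M i k * M k j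

theorem IsDirectedTree.locallyRecursive_trek (hT : G.IsDirectedTree) :
    G.LocallyRecursive (G.trek w) := by
  intro i _ j hj
  rw [trek_of_mem_nd w hj]
  refine Finset.sum_congr rfl fun k hk => ?_
  rw [G.trek_comm w i k, hT.trek_of_edge w (G.mem_pa.1 hk)]

/-- Induction along the topological order: the entries among earlier nodes are already treks, which
makes the parents of `i` orthonormal. Only then does `LocallyRecursive` supply the regression
equation for row `i`. -/
theorem IsDirectedTree.eq_trek (hT : G.IsDirectedTree) {M : Fin n → Fin n → R}
    (hcomm : ∀ i j, M i j = M j i) (hdiag : ∀ i, M i i = 1) (hM : G.LocallyRecursive M) :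
    M = G.trek M := by
  have key : ∀ i j, G.topo j < G.topo i → M i j = G.trek M i j := by
    intro i
    induction hN : G.topo i using Nat.strong_induction_on generalizing i with
    | _ N ih =>
      subst hN
      intro j hji
      have hall : ∀ k l, G.topo k < G.topo i → G.topo l < G.topo i → M k l = G.trek M k l := by
        intro k l hk hl
        rcases lt_trichotomy (G.topo l) (G.topo k) with hlk | hlk | hlk
        · exact ih _ hk k rfl l hlk
        · rw [G.topo_injective hlk, hdiag, trek_self]
        · rw [hcomm, G.trek_comm]
          exact ih _ hl l rfl k hlk
      have hpar : G.OrthonormalParents M i := by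
        intro k hk l hl
        rw [hall k l (G.topo_lt_of_mem_pa hk) (G.topo_lt_of_mem_pa hl)]
        exact hT.orthonormalParents_trek M i k hk l hl
      rw [hM i hpar j (G.mem_nd_of_topo_lt hji), G.trek_of_topo_lt M hji]
      refine Finset.sum_congr rfl fun k hk => ?_
      rw [hcomm i k, hall k j (G.topo_lt_of_mem_pa hk) hji]
  funext i j
  rcases lt_trichotomy (G.topo j) (G.topo i) with h | h | h
  · exact key i j h
  · rw [G.topo_injective h, hdiag, trek_self]
  · rw [hcomm, G.trek_comm]
    exact key j i h

theorem trek_zero (G : DAGModel n) (i j : Fin n) :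
    G.trek (fun _ _ => (0 : R)) i j = if i = j then 1 else 0 := by
  induction i, j using G.topo_induction with
  | self i => simp
  | gt i j h _ =>
    have : i ≠ j := by
      rintro rfl
      exact lt_irrefl _ h
    simp [G.trek_of_topo_lt _ h, this]
  | lt i j h _ =>
    have : i ≠ j := by
      rintro rfl
      exact lt_irrefl _ h
    simp [G.trek_of_topo_lt' _ h, this]

end Trek

/-! ### Imposed minors as regression equations -/

section Minors

variable {n : ℕ} {R : Type} [CommRing R]

theorem map_ciMinor {S : Type} [CommRing S] (f : R →+* S) (M : Matrix (Fin n) (Fin n) R)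
    (i j : Fin n) (K : Finset (Fin n)) :
    f (ciMinor M i j K) = ciMinor (M.map f) i j K := by
  rw [ciMinor, ciMinor, RingHom.map_det]
  rfl

/-- Schur complement of the `K × K` block, which is the identity by `hK`. -/
theorem ciMinor_eq (M : Matrix (Fin n) (Fin n) R) (i j : Fin n) (K : Finset (Fin n))
    (hK : ∀ k ∈ K, ∀ l ∈ K, M k l = if k = l then 1 else 0) :
    ciMinor M i j K = M i j - ∑ k ∈ K, M i k * M k j := by
  let e : Unit ⊕ K ≃ Option K := (Equiv.sumComm _ _).trans (Equiv.optionEquivSumPUnit K).symm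
  have h : (M.submatrix (fun a : Option K => a.elim i fun k => k.1)
      (fun a : Option K => a.elim j fun k => k.1)).submatrix e e =
      Matrix.fromBlocks (Matrix.of fun _ _ : Unit => M i j)
        (Matrix.of fun (_ : Unit) (k : K) => M i k) (Matrix.of fun (k : K) (_ : Unit) => M k j) 1 := by
    ext (a | a) (b | b)
    · rfl
    · rfl
    · rfl
    · simp only [Matrix.fromBlocks_apply₂₂, Matrix.one_apply]
      refine (hK a a.2 b b.2).trans ?_
      simp only [Subtype.ext_iff]
  rw [ciMinor, ← Matrix.det_submatrix_equiv_self e, h, Matrix.det_fromBlocks_one₂₂,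
    Matrix.det_unique]
  simp only [Matrix.sub_apply, Matrix.mul_apply, Matrix.of_apply]
  rw [← Finset.sum_coe_sort K fun k => M i k * M k j]

variable {G : DAGModel n}

theorem locallyRecursive_of_ciMinor_eq_zero {M : Matrix (Fin n) (Fin n) R}
    (h : ∀ i, ∀ j ∈ G.nd i, ciMinor M i j (G.pa i) = 0) : G.LocallyRecursive M := by
  intro i hi j hj
  have := h i j hj
  rwa [ciMinor_eq M i j _ hi, sub_eq_zero] at this

theorem IsDirectedTree.ciMinor_trek (hT : G.IsDirectedTree) (w : Fin n → Fin n → R) {i j : Fin n}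
    (hj : j ∈ G.nd i) : ciMinor (Matrix.of (G.trek w)) i j (G.pa i) = 0 := by
  rw [ciMinor_eq (Matrix.of (G.trek w)) _ _ _ (hT.orthonormalParents_trek w i), sub_eq_zero]
  exact hT.locallyRecursive_trek w i (hT.orthonormalParents_trek w i) j hj

theorem IsDirectedTree.ciMinor_eq_zero_iff (hT : G.IsDirectedTree) {M : Matrix (Fin n) (Fin n) R}
    (hcomm : ∀ i j, M i j = M j i) (hdiag : ∀ i, M i i = 1) :
    (∀ i, ∀ j ∈ G.nd i, ciMinor M i j (G.pa i) = 0) ↔ M = Matrix.of (G.trek M) := by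
  constructor
  · exact fun h => hT.eq_trek hcomm hdiag (locallyRecursive_of_ciMinor_eq_zero h)
  · intro h i j hj
    rw [h]
    exact hT.ciMinor_trek _ hj

end Minors

open MeasureTheory ProbabilityTheory

/-! ### Conditional independence and independent residuals -/

section CondIndep

variable {Ω : Type*} {mΩ : MeasurableSpace Ω} {β γ : Type*} [MeasurableSpace β]
  [MeasurableSpace γ] {μ : Measure Ω} [IsFiniteMeasure μ]

/-- If `U` is independent of `W`, then the conditional law of `U + g W` given `W = w` is the law
of `U + g w`. -/
theorem condDistrib_add_ae_eq {U : Ω → ℝ} {W : Ω → β} (hU : Measurable U) (hW : Measurable W)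
    (h : IndepFun W U μ) {g : β → ℝ} (hg : Measurable g) :
    condDistrib (fun ω => U ω + g (W ω)) W μ =ᵐ[μ.map W]
      (Kernel.id ×ₖ Kernel.const β (μ.map U)).map fun p => p.2 + g p.1 := by
  refine condDistrib_ae_eq_of_measure_eq_compProd W (by fun_prop) ?_
  have hm : Measurable fun p : β × ℝ => p.2 + g p.1 := by fun_prop
  have h1 : μ.map (fun ω => (W ω, U ω + g (W ω))) =
      ((μ.map W).prod (μ.map U)).map fun p => (p.1, p.2 + g p.1) := by
    rw [← (indepFun_iff_map_prod_eq_prod_map_map hW.aemeasurable hU.aemeasurable).1 h,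
      Measure.map_map (by fun_prop) (by fun_prop)]
    rfl
  rw [h1]
  refine Measure.ext_prod fun {s t} hs ht => ?_
  rw [Measure.map_apply (by fun_prop) (hs.prod ht), Measure.prod_apply (by measurability),
    Measure.compProd_apply_prod hs ht, ← lintegral_indicator hs]
  refine lintegral_congr fun w => ?_
  by_cases hw : w ∈ s
  · rw [Set.indicator_of_mem hw, Kernel.map_apply' _ hm _ ht, Kernel.prod_apply, Kernel.id_apply,
      Kernel.const_apply, Measure.dirac_prod, Measure.map_apply (by fun_prop) (hm ht)]
    congr 1
    ext u
    simp [hw]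
  · rw [Set.indicator_of_notMem hw]
    convert measure_empty (μ := μ.map U)
    ext u
    simp [hw]

/-- Given `Z`, and equally given `(Z, Y)`, the conditional law is that of `U` translated by `g Z`.
-/
theorem condIndepFun_add_of_indepFun [StandardBorelSpace Ω] [StandardBorelSpace β] [Nonempty β]
    {U : Ω → ℝ} {Y : Ω → β} {Z : Ω → γ}
    (hU : Measurable U) (hY : Measurable Y) (hZ : Measurable Z)
    (h : IndepFun U (fun ω => (Z ω, Y ω)) μ) {g : γ → ℝ} (hg : Measurable g) :
    CondIndepFun (MeasurableSpace.comap Z inferInstance) hZ.comap_le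
      (fun ω => U ω + g (Z ω)) Y μ := by
  refine CondIndepFun.symm ?_
  rw [condIndepFun_iff_condDistrib_prod_ae_eq_prodMkRight (by fun_prop) hY hZ]
  have h1 := condDistrib_add_ae_eq hU hZ (h.comp measurable_id measurable_fst).symm hg
  have h2 := condDistrib_add_ae_eq hU (hZ.prodMk hY) h.symm (hg.comp measurable_fst)
  have h3 : Measure.QuasiMeasurePreserving Prod.fst (μ.map fun ω => (Z ω, Y ω)) (μ.map Z) := by
    refine ⟨measurable_fst, ?_⟩
    rw [Measure.map_map measurable_fst (by fun_prop)]
    rfl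
  filter_upwards [h2, h3.ae h1] with p hp1 hp2
  rw [Kernel.prodMkRight_apply, hp2]
  refine hp1.trans ?_
  have m1 : Measurable fun q : γ × ℝ => q.2 + g q.1 := by fun_prop
  have m2 : Measurable fun q : (γ × β) × ℝ => q.2 + (g ∘ Prod.fst) q.1 := by fun_prop
  rw [Kernel.map_apply _ m1, Kernel.map_apply _ m2, Kernel.prod_apply, Kernel.prod_apply,
    Kernel.id_apply, Kernel.id_apply, Kernel.const_apply, Kernel.const_apply, Measure.dirac_prod,
    Measure.dirac_prod, Measure.map_map m1 (by fun_prop), Measure.map_map m2 (by fun_prop)]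
  rfl

theorem condExp_prodMk_ae_eq_of_condIndepFun [StandardBorelSpace Ω] {X Y : Ω → ℝ} {Z : Ω → γ}
    (hX : Measurable X) (hY : Measurable Y) (hZ : Measurable Z) (hXint : Integrable X μ)
    (h : CondIndepFun (MeasurableSpace.comap Z inferInstance) hZ.comap_le X Y μ) :
    μ[X | MeasurableSpace.comap (fun ω => (Z ω, Y ω)) inferInstance] =ᵐ[μ]
      μ[X | MeasurableSpace.comap Z inferInstance] := by
  have h1 := (condIndepFun_iff_condDistrib_prod_ae_eq_prodMkRight hX hY hZ).1 h.symm
  have h2 := ae_of_ae_map (hZ.prodMk hY).aemeasurable h1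
  filter_upwards [h2, condExp_ae_eq_integral_condDistrib' (hZ.prodMk hY) hXint,
    condExp_ae_eq_integral_condDistrib' hZ hXint] with ω e1 e2 e3
  rw [e2, e3, e1, Kernel.prodMkRight_apply]

/-- If `X` is the sum of `g Z` and of a variable independent of `Z`, and if `X` and `Y` are
conditionally independent given `Z`, then the residual `X - g Z` is uncorrelated with `Y`. -/
theorem covariance_sub_eq_zero_of_condIndepFun [StandardBorelSpace Ω] {P : Measure Ω}
    [IsProbabilityMeasure P] {X Y : Ω → ℝ} {Z : Ω → γ}
    (hX : Measurable X) (hY : Measurable Y) (hZ : Measurable Z) (hX2 : MemLp X 2 P)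
    (hY2 : MemLp Y 2 P) {g : γ → ℝ} (hg : Measurable g) (hg2 : MemLp (fun ω => g (Z ω)) 2 P)
    (hind : IndepFun (fun ω => X ω - g (Z ω)) Z P)
    (h : CondIndepFun (MeasurableSpace.comap Z inferInstance) hZ.comap_le X Y P) :
    cov[fun ω => X ω - g (Z ω), Y; P] = 0 := by
  let U : Ω → ℝ := fun ω => X ω - g (Z ω)
  change cov[U, Y; P] = 0
  have hU : Measurable U := by fun_prop
  have hU2 : MemLp U 2 P := hX2.sub hg2
  have hXint : Integrable X P := hX2.integrable (by norm_num)
  have hgint : Integrable (fun ω => g (Z ω)) P := hg2.integrable (by norm_num)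
  have hZY : Measurable fun ω => (Z ω, Y ω) := hZ.prodMk hY
  have hUZ : P[U | MeasurableSpace.comap Z inferInstance] =ᵐ[P] fun _ => ∫ ω, U ω ∂P :=
    condExp_indep_eq hU.comap_le hZ.comap_le
      (comap_measurable U).stronglyMeasurable ((IndepFun_iff_Indep _ _ _).1 hind)
  have hm : ∀ m : MeasurableSpace Ω, Measurable[m] Z → m ≤ mΩ →
      P[U | m] =ᵐ[P] fun ω => (P[X | m]) ω - g (Z ω) := by
    intro m hmZ hle
    have hgZ : StronglyMeasurable[m] fun ω => g (Z ω) := (hg.comp hmZ).stronglyMeasurable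
    refine (condExp_sub hXint hgint m).trans ?_
    rw [condExp_of_stronglyMeasurable hle hgZ hgint]
    rfl
  let m : MeasurableSpace Ω := MeasurableSpace.comap (fun ω => (Z ω, Y ω)) inferInstance
  have hmle : m ≤ mΩ := hZY.comap_le
  have hZm : Measurable[m] Z := measurable_fst.comp (comap_measurable fun ω => (Z ω, Y ω))
  have hYm : Measurable[m] Y := measurable_snd.comp (comap_measurable fun ω => (Z ω, Y ω))
  -- Adding `Y` to the conditioning changes neither `E[X | Z]` nor the subtracted `g Z`, so `E[U |
  -- Z, Y] = E[U | Z]`, a constant by independence.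
  have hU' : P[U | m] =ᵐ[P] fun _ => ∫ ω, U ω ∂P := by
    filter_upwards [hm m hZm hmle, hm _ (comap_measurable Z) hZ.comap_le, hUZ,
      condExp_prodMk_ae_eq_of_condIndepFun hX hY hZ hXint h] with ω e1 e2 e3 e4
    rw [e1, e4, ← e2, e3]
  have hUYint : Integrable (U * Y) P := hU2.integrable_mul hY2
  have hUint : Integrable U P := hU2.integrable (by norm_num)
  rw [covariance_eq_sub hU2 hY2, ← integral_condExp hmle (f := U * Y),
    integral_congr_ae (condExp_mul_of_stronglyMeasurable_right hYm.stronglyMeasurable hUYint hUint),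
    sub_eq_zero, ← integral_const_mul]
  refine integral_congr_ae ?_
  filter_upwards [hU'] with ω e
  simp [e]

end CondIndep

open MeasureTheory ProbabilityTheory

/-! ### Real trek matrices as Gram matrices -/

section Gram

variable {n : ℕ} (G : DAGModel n)

/-- The coefficients of the variables of the linear structural equation model with edge weights
`w` in terms of uncorrelated errors, the error of the node `i` having standard deviation `s i`. -/
noncomputable def errorCoeff (w : Fin n → Fin n → ℝ) (s : Fin n → ℝ) (i a : Fin n) : ℝ :=
  if a = i then s i else ∑ k : {k // k ∈ G.pa i}, w k i * errorCoeff w s k a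
termination_by G.topo i
decreasing_by exact G.topo_lt_of_mem_pa k.2

variable (w : Fin n → Fin n → ℝ) (s : Fin n → ℝ)

theorem errorCoeff_self (i : Fin n) : G.errorCoeff w s i i = s i := by
  rw [errorCoeff, if_pos rfl]

theorem errorCoeff_of_ne {i a : Fin n} (h : a ≠ i) :
    G.errorCoeff w s i a = ∑ k ∈ G.pa i, w k i * G.errorCoeff w s k a := by
  rw [errorCoeff, if_neg h]
  exact Finset.sum_coe_sort (G.pa i) fun k => w k i * G.errorCoeff w s k a

theorem errorCoeff_eq_zero {i a : Fin n} (h : G.topo i < G.topo a) :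
    G.errorCoeff w s i a = 0 := by
  induction hN : G.topo i using Nat.strong_induction_on generalizing i with
  | _ N ih =>
    subst hN
    have hne : a ≠ i := by
      rintro rfl
      exact lt_irrefl _ h
    rw [G.errorCoeff_of_ne w s hne]
    refine Finset.sum_eq_zero fun k hk => ?_
    have hki := G.topo_lt_of_mem_pa hk
    rw [ih _ hki (hki.trans h) rfl, mul_zero]

theorem sum_errorCoeff_mul_of_topo_lt {i j : Fin n} (h : G.topo j < G.topo i) :
    ∑ a, G.errorCoeff w s i a * G.errorCoeff w s j a =
      ∑ k ∈ G.pa i, w k i * ∑ a, G.errorCoeff w s k a * G.errorCoeff w s j a := by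
  simp_rw [Finset.mul_sum]
  rw [Finset.sum_comm]
  refine Finset.sum_congr rfl fun a _ => ?_
  by_cases ha : a = i
  · subst ha
    simp [G.errorCoeff_eq_zero w s h]
  · rw [G.errorCoeff_of_ne w s ha, Finset.sum_mul]
    exact Finset.sum_congr rfl fun k _ => by ring

theorem sum_errorCoeff_mul_self (i : Fin n) :
    ∑ a, G.errorCoeff w s i a * G.errorCoeff w s i a = s i ^ 2 +
      ∑ k ∈ G.pa i, ∑ l ∈ G.pa i, w k i * w l i *
        ∑ a, G.errorCoeff w s k a * G.errorCoeff w s l a := by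
  have h : ∀ a, G.errorCoeff w s i a * G.errorCoeff w s i a =
      (if a = i then s i ^ 2 else 0) +
        (∑ k ∈ G.pa i, w k i * G.errorCoeff w s k a) *
          ∑ l ∈ G.pa i, w l i * G.errorCoeff w s l a := by
    intro a
    by_cases ha : a = i
    · subst ha
      have : ∑ k ∈ G.pa a, w k a * G.errorCoeff w s k a = 0 :=
        Finset.sum_eq_zero fun k hk => by
          rw [G.errorCoeff_eq_zero w s (G.topo_lt_of_mem_pa hk), mul_zero]
      rw [this, errorCoeff_self, if_pos rfl]
      ring
    · rw [G.errorCoeff_of_ne w s ha, if_neg ha, zero_add]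
  simp_rw [h, Finset.sum_add_distrib, Finset.sum_ite_eq' Finset.univ i, if_pos (Finset.mem_univ i),
    Finset.sum_mul_sum, Finset.mul_sum]
  congr 1
  rw [Finset.sum_comm]
  refine Finset.sum_congr rfl fun k _ => ?_
  rw [Finset.sum_comm]
  exact Finset.sum_congr rfl fun l _ => Finset.sum_congr rfl fun a _ => by ring

variable {G}

/-- Covariances of the structural model obey the trek recursion. Since the parents are orthonormal,
the variance of `i` is `s i ^ 2 + ∑ w k i ^ 2`, which `hs` normalizes to one. -/
theorem IsDirectedTree.sum_errorCoeff_mul (hT : G.IsDirectedTree)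
    (hs : ∀ i, s i ^ 2 = 1 - ∑ k ∈ G.pa i, w k i ^ 2) (i j : Fin n) :
    ∑ a, G.errorCoeff w s i a * G.errorCoeff w s j a = G.trek w i j := by
  have hcomm : ∀ i j, ∑ a, G.errorCoeff w s i a * G.errorCoeff w s j a =
      ∑ a, G.errorCoeff w s j a * G.errorCoeff w s i a :=
    fun i j => Finset.sum_congr rfl fun a _ => mul_comm _ _
  have key : ∀ i j, G.topo j ≤ G.topo i →
      ∑ a, G.errorCoeff w s i a * G.errorCoeff w s j a = G.trek w i j := by
    intro i
    induction hN : G.topo i using Nat.strong_induction_on generalizing i with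
    | _ N ih =>
      subst hN
      intro j hj
      have hall : ∀ k l, G.topo k < G.topo i → G.topo l < G.topo i →
          ∑ a, G.errorCoeff w s k a * G.errorCoeff w s l a = G.trek w k l := by
        intro k l hk hl
        rcases le_total (G.topo l) (G.topo k) with h | h
        · exact ih _ hk k rfl l h
        · rw [hcomm, G.trek_comm]
          exact ih _ hl l rfl k h
      rcases hj.lt_or_eq with hj | hj
      · rw [G.sum_errorCoeff_mul_of_topo_lt w s hj, G.trek_of_topo_lt w hj]
        exact Finset.sum_congr rfl fun k hk => by rw [hall k j (G.topo_lt_of_mem_pa hk) hj]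
      · rw [G.topo_injective hj, G.sum_errorCoeff_mul_self, trek_self, hs]
        have : ∀ k ∈ G.pa i, ∑ l ∈ G.pa i, w k i * w l i *
            ∑ a, G.errorCoeff w s k a * G.errorCoeff w s l a = w k i ^ 2 := by
          intro k hk
          rw [Finset.sum_eq_single_of_mem k hk]
          · rw [hall k k (G.topo_lt_of_mem_pa hk) (G.topo_lt_of_mem_pa hk), trek_self]
            ring
          · intro l hl hne
            rw [hall k l (G.topo_lt_of_mem_pa hk) (G.topo_lt_of_mem_pa hl),
              hT.orthonormalParents_trek w i k hk l hl, if_neg hne.symm, mul_zero]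
        rw [Finset.sum_congr rfl this]
        ring
  rcases le_total (G.topo j) (G.topo i) with h | h
  · exact key i j h
  · rw [hcomm, G.trek_comm]
    exact key j i h

theorem IsDirectedTree.posSemidef_trek (hT : G.IsDirectedTree)
    (hw : ∀ i, ∑ k ∈ G.pa i, w k i ^ 2 ≤ 1) : (Matrix.of (G.trek w)).PosSemidef := by
  have h : Matrix.of (G.trek w) =
      Matrix.of (G.errorCoeff w fun i => √(1 - ∑ k ∈ G.pa i, w k i ^ 2)) *
        (Matrix.of (G.errorCoeff w fun i => √(1 - ∑ k ∈ G.pa i, w k i ^ 2))).conjTranspose := by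
    ext i j
    simp only [Matrix.of_apply, Matrix.mul_apply, Matrix.conjTranspose_apply, star_trivial]
    rw [hT.sum_errorCoeff_mul]
    exact fun i => Real.sq_sqrt (sub_nonneg.2 (hw i))
  rw [h]
  exact Matrix.posSemidef_self_mul_conjTranspose _

end Gram

/-! ### Gaussian laws and the local Markov property -/

section Gaussian

variable {n : ℕ}

theorem exists_isGaussian_covariance_eq {S : Matrix (Fin n) (Fin n) ℝ} (hS : S.PosSemidef) :
    ∃ P : ProbabilityMeasure (Fin n → ℝ), IsGaussian (P : Measure (Fin n → ℝ)) ∧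
      ∀ i j, cov[fun x : Fin n → ℝ => x i, fun x => x j; (P : Measure (Fin n → ℝ))] = S i j := by
  let L : EuclideanSpace ℝ (Fin n) →L[ℝ] (Fin n → ℝ) :=
    (EuclideanSpace.equiv (Fin n) ℝ).toContinuousLinearMap
  have hL : Measurable L := L.continuous.measurable
  have hg : IsGaussian ((multivariateGaussian 0 S).map L) := isGaussian_map L
  refine ⟨⟨(multivariateGaussian 0 S).map L, inferInstance⟩, hg, fun i j => ?_⟩
  rw [ProbabilityMeasure.coe_mk,
    covariance_map (measurable_pi_apply i).aestronglyMeasurable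
      (measurable_pi_apply j).aestronglyMeasurable hL.aemeasurable]
  exact covariance_eval_multivariateGaussian hS i j

variable {P : Measure (Fin n → ℝ)} [IsGaussian P]

theorem memLp_two_eval (i : Fin n) : MemLp (fun x : Fin n → ℝ => x i) 2 P :=
  IsGaussian.memLp_dual P (ContinuousLinearMap.proj (R := ℝ) (φ := fun _ : Fin n => ℝ) i) 2
    (by norm_num)

theorem covariance_sub_sum (i j : Fin n) (K : Finset (Fin n)) (b : Fin n → ℝ) :
    cov[fun x : Fin n → ℝ => x i - ∑ k ∈ K, b k * x k, fun x => x j; P] =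
      cov[fun x : Fin n → ℝ => x i, fun x => x j; P] -
        ∑ k ∈ K, b k * cov[fun x : Fin n → ℝ => x k, fun x => x j; P] := by
  have h : ∀ k ∈ K, MemLp (fun x : Fin n → ℝ => b k * x k) 2 P :=
    fun k _ => (memLp_two_eval k).const_mul (b k)
  rw [covariance_fun_sub_left (memLp_two_eval i) (memLp_finsetSum K h) (memLp_two_eval j),
    covariance_fun_sum_left' h (memLp_two_eval j)]
  simp_rw [covariance_const_mul_left]

/-- The residual and the coordinates in `J` are jointly Gaussian, so being uncorrelated makes them
independent. -/
theorem indepFun_sub_sum_restrict (i : Fin n) (K J : Finset (Fin n)) (b : Fin n → ℝ)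
    (h : ∀ j ∈ J, cov[fun x : Fin n → ℝ => x i, fun x => x j; P] =
      ∑ k ∈ K, b k * cov[fun x : Fin n → ℝ => x k, fun x => x j; P]) :
    IndepFun (fun x : Fin n → ℝ => x i - ∑ k ∈ K, b k * x k)
      (Finset.restrict (π := fun _ : Fin n => ℝ) J) P := by
  let pr : Fin n → ((Fin n → ℝ) →L[ℝ] ℝ) :=
    ContinuousLinearMap.proj (R := ℝ) (φ := fun _ : Fin n => ℝ)
  let L : (Fin n → ℝ) →L[ℝ] (Unit → ℝ) × (J → ℝ) :=
    (ContinuousLinearMap.pi fun _ => pr i - ∑ k ∈ K, b k • pr k).prod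
      (ContinuousLinearMap.pi fun j : J => pr j)
  have hlaw : HasGaussianLaw (fun x : Fin n → ℝ =>
      (fun _ : Unit => x i - ∑ k ∈ K, b k * x k, fun j : J => x j)) P := by
    have := (IsGaussian.hasGaussianLaw_id (μ := P)).map_fun L
    simpa [L, pr, Pi.sub_def] using this
  have hind := hlaw.indepFun_of_covariance_eval (X := fun _ (x : Fin n → ℝ) => x i - ∑ k ∈ K, b k * x k)
    (Y := fun (j : J) (x : Fin n → ℝ) => x j) (fun _ j => by rw [covariance_sub_sum, h j j.2, sub_self])
  exact hind.comp (φ := fun u : Unit → ℝ => u ()) (ψ := id) (by fun_prop) measurable_id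

variable {G : DAGModel n}

theorem condIndepCoord_of_covariance_eq (i : Fin n) (b : Fin n → ℝ)
    (h : ∀ j ∈ G.nd i, cov[fun x : Fin n → ℝ => x i, fun x => x j; P] =
      ∑ k ∈ G.pa i, b k * cov[fun x : Fin n → ℝ => x k, fun x => x j; P]) :
    CondIndepCoord P {i} (G.nd i) (G.pa i) := by
  have hind := indepFun_sub_sum_restrict i (G.pa i) (G.nd i) b h
  have hind' := hind.comp (φ := id)
    (ψ := fun y : G.nd i → ℝ => (fun k : G.pa i => y ⟨k, G.pa_subset_nd i k.2⟩, y))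
    measurable_id (by fun_prop)
  have hci := condIndepFun_add_of_indepFun (Y := Finset.restrict (π := fun _ : Fin n => ℝ) (G.nd i))
    (Z := Finset.restrict (π := fun _ : Fin n => ℝ) (G.pa i))
    (U := fun x : Fin n → ℝ => x i - ∑ k ∈ G.pa i, b k * x k) (by fun_prop)
    (Finset.measurable_restrict _) (Finset.measurable_restrict _) hind'
    (g := fun z => ∑ k : G.pa i, b k * z k) (by fun_prop)
  have hci' := hci.comp (φ := fun (u : ℝ) (_ : ({i} : Finset (Fin n))) => u) (ψ := id)
    (by fun_prop) measurable_id
  have heq : (fun (u : ℝ) (_ : ({i} : Finset (Fin n))) => u) ∘ (fun x : Fin n → ℝ =>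
      (x i - ∑ k ∈ G.pa i, b k * x k) + ∑ k : G.pa i, b k *
        (Finset.restrict (π := fun _ : Fin n => ℝ) (G.pa i) x) k) =
      Finset.restrict (π := fun _ : Fin n => ℝ) {i} := by
    funext x a
    have ha : (a : Fin n) = i := Finset.mem_singleton.1 a.2
    simp only [Function.comp_apply, Finset.restrict]
    rw [Finset.sum_coe_sort (G.pa i) fun k => b k * x k, sub_add_cancel, ha]
  rw [heq] at hci'
  exact hci'

/-- Orthonormal parents make the covariances themselves the regression coefficients, so no
covariance matrix is inverted and degenerate laws are covered. -/
theorem locallyRecursive_covariance (h : ∀ i, CondIndepCoord P {i} (G.nd i) (G.pa i)) :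
    G.LocallyRecursive fun i j => cov[fun x : Fin n → ℝ => x i, fun x => x j; P] := by
  intro i hi' j hj
  have hi : ∀ k ∈ G.pa i, ∀ l ∈ G.pa i,
      cov[fun x : Fin n → ℝ => x k, fun x => x l; P] = if k = l then 1 else 0 := hi'
  have hij : CondIndepFun
      (MeasurableSpace.comap (Finset.restrict (π := fun _ : Fin n => ℝ) (G.pa i)) inferInstance)
      (Finset.measurable_restrict (X := fun _ : Fin n => ℝ) (G.pa i)).comap_le
      (fun x : Fin n → ℝ => x i) (fun x => x j) P := (h i).comp
    (φ := fun u : ({i} : Finset (Fin n)) → ℝ => u ⟨i, by simp⟩)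
    (ψ := fun u : G.nd i → ℝ => u ⟨j, hj⟩) (measurable_pi_apply _) (measurable_pi_apply _)
  let b : Fin n → ℝ := fun k => cov[fun x : Fin n → ℝ => x i, fun x => x k; P]
  have hind := indepFun_sub_sum_restrict (P := P) i (G.pa i) (G.pa i) b (by
    intro l hl
    rw [Finset.sum_eq_single_of_mem l hl]
    · rw [hi l hl l hl, if_pos rfl, mul_one]
    · intro k hk hne
      rw [hi k hk l hl, if_neg hne, mul_zero])
  have hsum : ∀ x : Fin n → ℝ, ∑ k : G.pa i, b k *
      (Finset.restrict (π := fun _ : Fin n => ℝ) (G.pa i) x) k = ∑ k ∈ G.pa i, b k * x k :=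
    fun x => Finset.sum_coe_sort (G.pa i) fun k => b k * x k
  have hcov := covariance_sub_eq_zero_of_condIndepFun (P := P) (X := fun x : Fin n → ℝ => x i)
    (Y := fun x => x j) (Z := Finset.restrict (π := fun _ : Fin n => ℝ) (G.pa i))
    (by fun_prop) (by fun_prop) (Finset.measurable_restrict _) (memLp_two_eval i)
    (memLp_two_eval j) (g := fun z => ∑ k : G.pa i, b k * z k) (by fun_prop)
    (by
      simp_rw [hsum]
      exact memLp_finsetSum _ fun k _ => (memLp_two_eval k).const_mul (b k))
    (by
      simp_rw [hsum]
      exact hind) hij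
  simp_rw [hsum] at hcov
  rwa [covariance_sub_sum, sub_eq_zero] at hcov

end Gaussian

open MvPolynomial

/-! ### The parametrization by edge weights -/

section EdgeRing

variable {n : ℕ} (G : DAGModel n)

/-- The edges of a directed acyclic graph. -/
abbrev EdgeSet : Type := {e : Fin n × Fin n // G.Edge e.1 e.2}

open Classical in
/-- The edge variables, as a matrix of weights. -/
noncomputable def edgeVar (k i : Fin n) : MvPolynomial G.EdgeSet ℂ :=
  if h : G.Edge k i then X ⟨(k, i), h⟩ else 0

theorem edgeVar_of_edge {k i : Fin n} (h : G.Edge k i) : G.edgeVar k i = X ⟨(k, i), h⟩ :=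
  dif_pos h

/-- A matrix of correlations of the model, as a point of the space of symmetric matrices. -/
noncomputable def trekPoint {R : Type*} [CommRing R] (w : Fin n → Fin n → R) :
    Sym2 (Fin n) → R :=
  Sym2.lift ⟨G.trek w, G.trek_comm w⟩

@[simp]
theorem trekPoint_mk {R : Type*} [CommRing R] (w : Fin n → Fin n → R) (i j : Fin n) :
    G.trekPoint w s(i, j) = G.trek w i j := rfl

theorem map_trekPoint {R S : Type*} [CommRing R] [CommRing S] (f : R →+* S)
    {w : Fin n → Fin n → R} {w' : Fin n → Fin n → S}
    (h : ∀ k i, G.Edge k i → f (w k i) = w' k i) (e : Sym2 (Fin n)) :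
    f (G.trekPoint w e) = G.trekPoint w' e := by
  induction e with
  | _ i j => exact G.map_trek w f h i j

/-- The parametrization of the correlation matrices of the model, on coordinate rings. -/
noncomputable def param : PolySig n →ₐ[ℂ] MvPolynomial G.EdgeSet ℂ :=
  aeval (G.trekPoint G.edgeVar)

/-- The parametrization of the correlation matrices of the model, on the coordinate ring of the
matrices with unit diagonal. -/
noncomputable def paramHat : PolySigHat n →ₐ[ℂ] MvPolynomial G.EdgeSet ℂ :=
  aeval fun e => G.trekPoint G.edgeVar e.1

/-- The point of the edge space with the coordinates `w`. -/
def edgeWeights (w : Fin n → Fin n → ℂ) (e : G.EdgeSet) : ℂ := w e.1.1 e.1.2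

theorem eval_edgeVar (w : Fin n → Fin n → ℂ) {k i : Fin n} (h : G.Edge k i) :
    aeval (G.edgeWeights w) (G.edgeVar k i) = w k i := by
  rw [G.edgeVar_of_edge h, aeval_X]
  rfl

theorem aeval_trekPoint_edgeVar (w : Fin n → Fin n → ℂ) (e : Sym2 (Fin n)) :
    aeval (G.edgeWeights w) (G.trekPoint G.edgeVar e) = G.trekPoint w e :=
  G.map_trekPoint (w' := w) (aeval (G.edgeWeights w) : _ →ₐ[ℂ] ℂ).toRingHom
    (fun _ _ h => G.eval_edgeVar w h) e

theorem aeval_param (w : Fin n → Fin n → ℂ) (f : PolySig n) :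
    aeval (G.edgeWeights w) (G.param f) = aeval (G.trekPoint w) f := by
  have : (aeval (G.edgeWeights w)).comp G.param = aeval (G.trekPoint w) := by
    ext1 e
    rw [AlgHom.comp_apply, param, aeval_X, aeval_X, aeval_trekPoint_edgeVar]
  exact DFunLike.congr_fun this f

theorem aeval_paramHat (w : Fin n → Fin n → ℂ) (f : PolySigHat n) :
    aeval (G.edgeWeights w) (G.paramHat f) = aeval (offDiagCoord (G.trekPoint w)) f := by
  have : (aeval (G.edgeWeights w)).comp G.paramHat = aeval (offDiagCoord (G.trekPoint w)) := by
    ext1 e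
    rw [AlgHom.comp_apply, paramHat, aeval_X, aeval_X, aeval_trekPoint_edgeVar, offDiagCoord]
  exact DFunLike.congr_fun this f

/-- The admissible weights contain a product of infinite sets, on which only the zero polynomial
vanishes. -/
theorem eq_zero_of_forall_small {p : MvPolynomial G.EdgeSet ℂ}
    (h : ∀ w : Fin n → Fin n → ℝ, (∀ i, ∑ k ∈ G.pa i, w k i ^ 2 ≤ 1) →
      aeval (G.edgeWeights fun k i => (w k i : ℂ)) p = 0) : p = 0 := by
  classical
  -- As `c ≤ 1`, weights in `[0, c]` have squares at most `c`, and a node has at most `n` parents.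
  let c : ℝ := 1 / (n + 1)
  have hc : 0 < c := by positivity
  refine MvPolynomial.funext_set (fun _ => (fun r : ℝ => (r : ℂ)) '' Set.Icc 0 c) (fun _ => ?_) ?_
  · exact (Set.Icc_infinite hc).image Complex.ofReal_injective.injOn
  · intro x hx
    choose r hr hrx using fun e => hx e (Set.mem_univ e)
    let w : Fin n → Fin n → ℝ := fun k i => if h : G.Edge k i then r ⟨(k, i), h⟩ else 0
    have hw : ∀ k i, w k i ^ 2 ≤ c := by
      intro k i
      have h01 : 0 ≤ w k i ∧ w k i ≤ c := by
        dsimp only [w]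
        split_ifs with h
        · exact ⟨(hr _).1, (hr _).2⟩
        · exact ⟨le_rfl, hc.le⟩
      have hc1 : c ≤ 1 := by
        dsimp only [c]
        rw [div_le_one (by positivity)]
        linarith [(Nat.cast_nonneg n : (0 : ℝ) ≤ n)]
      nlinarith [h01.1, h01.2]
    have hxw : x = G.edgeWeights fun k i => (w k i : ℂ) := by
      funext e
      rw [← hrx e]
      simp only [edgeWeights, w, dif_pos e.2]
    rw [map_zero, hxw, ← MvPolynomial.coe_aeval_eq_eval]
    refine h w fun i => ?_
    calc ∑ k ∈ G.pa i, w k i ^ 2 ≤ ∑ k ∈ G.pa i, c := Finset.sum_le_sum fun k _ => hw k i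
      _ = (G.pa i).card * c := by rw [Finset.sum_const, nsmul_eq_mul]
      _ ≤ (n + 1) * c := by
          have : ((G.pa i).card : ℝ) ≤ n := by
            exact_mod_cast (Finset.card_le_univ _).trans_eq (Fintype.card_fin n)
          gcongr
          linarith
      _ = 1 := by
          dsimp only [c]
          field_simp

end EdgeRing

/-! ### The imposed ideal as a kernel -/

section IdealHat

variable {n : ℕ} {G : DAGModel n}

theorem genericMatrixHat_comm (i j : Fin n) : genericMatrixHat n i j = genericMatrixHat n j i := by
  simp only [genericMatrixHat, Matrix.of_apply, Sym2.eq_swap (a := i) (b := j)]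

theorem genericMatrixHat_self (i : Fin n) : genericMatrixHat n i i = 1 := by
  simp [genericMatrixHat]

theorem genericMatrixHat_of_ne {i j : Fin n} (h : i ≠ j) :
    genericMatrixHat n i j = X ⟨s(i, j), by simpa using h⟩ := by
  simp [genericMatrixHat, h]

theorem map_genericMatrixHat_of_trek {R : Type*} [CommRing R] [Algebra ℂ R]
    (w : Fin n → Fin n → R) :
    (genericMatrixHat n).map (aeval (R := ℂ) fun e : OffDiag n => G.trekPoint w e.1) =
      Matrix.of (G.trek w) := by
  ext i j
  rw [Matrix.map_apply, Matrix.of_apply]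
  by_cases h : i = j
  · subst h
    rw [genericMatrixHat_self, map_one, trek_self]
  · rw [genericMatrixHat_of_ne h, aeval_X, trekPoint_mk]

/-- The specialization of the edge variables to the entries of the generic matrix. -/
noncomputable def edgeEntry (G : DAGModel n) : MvPolynomial G.EdgeSet ℂ →ₐ[ℂ] PolySigHat n :=
  aeval fun e => genericMatrixHat n e.1.1 e.1.2

theorem imposedIdealOf_le_ker_iff {R S : Type} [CommRing R] [CommRing S]
    (M : Matrix (Fin n) (Fin n) R) (f : R →+* S) :
    G.imposedIdealOf M ≤ RingHom.ker f ↔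
      ∀ i, ∀ j ∈ G.nd i, ciMinor (M.map f) i j (G.pa i) = 0 := by
  rw [imposedIdealOf, Ideal.span_le]
  constructor
  · intro h i j hj
    rw [← map_ciMinor]
    exact h ⟨i, j, hj, rfl⟩
  · rintro h _ ⟨i, j, hj, rfl⟩
    rw [SetLike.mem_coe, RingHom.mem_ker, map_ciMinor]
    exact h i j hj

theorem IsDirectedTree.imposedIdealHat_eq_ker (hT : G.IsDirectedTree) :
    G.imposedIdealHat = RingHom.ker G.paramHat := by
  apply le_antisymm
  · refine (imposedIdealOf_le_ker_iff _ G.paramHat.toRingHom).2 fun i j hj => ?_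
    have : (genericMatrixHat n).map G.paramHat.toRingHom = Matrix.of (G.trek G.edgeVar) :=
      map_genericMatrixHat_of_trek (G := G) G.edgeVar
    rw [this]
    exact hT.ciMinor_trek _ hj
  · intro f hf
    let q := Ideal.Quotient.mkₐ ℂ G.imposedIdealHat
    have hM : (genericMatrixHat n).map q = Matrix.of (G.trek ((genericMatrixHat n).map q)) := by
      refine (hT.ciMinor_eq_zero_iff (fun i j => ?_) fun i => ?_).1 ?_
      · rw [Matrix.map_apply, Matrix.map_apply, genericMatrixHat_comm]
      · rw [Matrix.map_apply, genericMatrixHat_self, map_one]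
      · refine (imposedIdealOf_le_ker_iff (genericMatrixHat n) q.toRingHom).1 ?_
        exact (Ideal.Quotient.mkₐ_ker ℂ G.imposedIdealHat).ge
    -- In the quotient the generic matrix is `trek` of its own edge entries, so the quotient map
    -- factors through `paramHat` and kills its kernel.
    have hq : (q.comp G.edgeEntry).comp G.paramHat = q := by
      ext1 ⟨e, he⟩
      induction e with
      | _ i j =>
        have hij : i ≠ j := by simpa using he
        have h1 : (q.comp G.edgeEntry) (G.trek G.edgeVar i j) =
            G.trek ((genericMatrixHat n).map q) i j :=
          G.map_trek _ (q.comp G.edgeEntry).toRingHom (fun k l h => by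
            simp [edgeVar_of_edge G h, edgeEntry]) i j
        have h2 := congrFun (congrFun hM i) j
        rw [Matrix.map_apply, genericMatrixHat_of_ne hij, Matrix.of_apply, ← h1] at h2
        simpa [paramHat] using h2.symm
    rw [← Ideal.Quotient.eq_zero_iff_mem, ← Ideal.Quotient.mkₐ_eq_mk ℂ]
    change q f = 0
    rw [← hq, AlgHom.comp_apply, show G.paramHat f = 0 from hf, map_zero]

end IdealHat

/-! ### Varieties, smoothness and saturation -/

section Varieties

open MeasureTheory ProbabilityTheory

variable {n : ℕ} {G : DAGModel n}

theorem eval_genericMatrix (x : Sig n) :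
    (genericMatrix n).map (aeval x : PolySig n →ₐ[ℂ] ℂ) = Matrix.of fun i j => x s(i, j) := by
  ext i j
  simp [genericMatrix]

theorem mem_zeroLocus_imposedIdeal_iff (x : Sig n) :
    x ∈ zeroLocus ℂ G.imposedIdeal ↔
      ∀ i, ∀ j ∈ G.nd i, ciMinor (Matrix.of fun i j => x s(i, j)) i j (G.pa i) = 0 := by
  rw [← eval_genericMatrix]
  exact imposedIdealOf_le_ker_iff (genericMatrix n) (aeval x : PolySig n →ₐ[ℂ] ℂ).toRingHom

theorem IsDirectedTree.zeroLocus_inter_sigHat (hT : G.IsDirectedTree) :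
    zeroLocus ℂ G.imposedIdeal ∩ sigHat n = Set.range G.trekPoint := by
  ext x
  rw [Set.mem_inter_iff, mem_zeroLocus_imposedIdeal_iff, Set.mem_range]
  constructor
  · rintro ⟨h, hx⟩
    refine ⟨fun i j => x s(i, j), ?_⟩
    have := (hT.ciMinor_eq_zero_iff (M := Matrix.of fun i j => x s(i, j))
      (fun i j => congrArg x Sym2.eq_swap) hx).1 h
    funext e
    induction e with
    | _ i j => exact (congrFun (congrFun this i) j).symm
  · rintro ⟨w, rfl⟩
    exact ⟨fun i j hj => hT.ciMinor_trek w hj, fun i => G.trek_self w i⟩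

theorem IsDirectedTree.loc_inter_sigHat_subset (hT : G.IsDirectedTree) :
    G.loc ∩ sigHat n ⊆ Set.range G.trekPoint := by
  rintro _ ⟨⟨P, ⟨hP, hPg⟩, rfl⟩, hx⟩
  have : IsGaussian (P : Measure (Fin n → ℝ)) := hPg
  let M : Fin n → Fin n → ℝ := fun i j =>
    cov[fun x : Fin n → ℝ => x i, fun x => x j; (P : Measure (Fin n → ℝ))]
  have hM : M = G.trek M := by
    refine hT.eq_trek (fun i j => covariance_comm _ _) (fun i => ?_) ?_
    · exact Complex.ofReal_injective (hx i)
    · exact locallyRecursive_covariance hP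
  refine ⟨fun i j => (M i j : ℂ), ?_⟩
  funext e
  induction e with
  | _ i j =>
    have h := G.map_trek M Complex.ofRealHom (w' := fun i j => (M i j : ℂ)) (fun _ _ _ => rfl) i j
    rw [← hM] at h
    exact h.symm

theorem IsDirectedTree.trekPoint_mem_loc (hT : G.IsDirectedTree) {w : Fin n → Fin n → ℝ}
    (hw : ∀ i, ∑ k ∈ G.pa i, w k i ^ 2 ≤ 1) :
    G.trekPoint (fun k i => (w k i : ℂ)) ∈ G.loc ∩ sigHat n := by
  refine ⟨?_, fun i => G.trek_self _ i⟩
  obtain ⟨P, hP, hcov⟩ := exists_isGaussian_covariance_eq (hT.posSemidef_trek w hw)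
  refine ⟨P, ⟨fun i => ?_, hP⟩, ?_⟩
  · refine condIndepCoord_of_covariance_eq i (fun k => w k i) fun j hj => ?_
    simp_rw [hcov]
    exact trek_of_mem_nd w hj
  · funext e
    induction e with
    | _ i j =>
      refine (congrArg Complex.ofReal (hcov i j)).trans ?_
      exact G.map_trek w Complex.ofRealHom (w' := fun k i => (w k i : ℂ)) (fun _ _ _ => rfl) i j

theorem IsDirectedTree.param_eq_zero (hT : G.IsDirectedTree) {f : PolySig n}
    (hf : f ∈ vanishingIdeal ℂ (G.loc ∩ sigHat n)) : G.param f = 0 := by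
  refine G.eq_zero_of_forall_small fun w hw => ?_
  rw [aeval_param]
  exact hf _ (hT.trekPoint_mem_loc hw)

/-- The image of the parametrization is Zariski closed, being cut out by the minors and `σ_ii = 1`;
density of the small real weights gives the other inclusion. -/
theorem IsDirectedTree.XHat_eq (hT : G.IsDirectedTree) : G.XHat = Set.range G.trekPoint := by
  apply Set.Subset.antisymm
  · intro x hx
    rw [← hT.zeroLocus_inter_sigHat]
    have hsub := hT.loc_inter_sigHat_subset
    rw [← hT.zeroLocus_inter_sigHat] at hsub
    constructor
    · intro f hf
      exact hx f fun y hy => (hsub hy).1 f hf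
    · intro i
      have := hx (X s(i, i) - 1) fun y hy => by
        rw [map_sub, aeval_X, map_one, hy.2 i, sub_self]
      rwa [map_sub, aeval_X, map_one, sub_eq_zero] at this
  · rintro _ ⟨w, rfl⟩ f hf
    rw [← aeval_param, hT.param_eq_zero hf, map_zero]

theorem forall_edgeWeights {p : MvPolynomial G.EdgeSet ℂ}
    (h : ∀ w, aeval (G.edgeWeights w) p = 0) : p = 0 :=
  G.eq_zero_of_forall_small fun w _ => h fun k i => (w k i : ℂ)

theorem IsDirectedTree.idealHat_XHat (hT : G.IsDirectedTree) :
    idealHat G.XHat = RingHom.ker G.paramHat := by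
  rw [hT.XHat_eq]
  ext f
  rw [idealHat, mem_vanishingIdeal_iff, RingHom.mem_ker]
  constructor
  · intro h
    refine forall_edgeWeights fun w => ?_
    rw [aeval_paramHat]
    exact h _ ⟨_, ⟨w, rfl⟩, rfl⟩
  · rintro h _ ⟨_, ⟨w, rfl⟩, rfl⟩
    rw [← aeval_paramHat, h, map_zero]

theorem IsDirectedTree.vanishingIdeal_XHat (hT : G.IsDirectedTree) :
    vanishingIdeal ℂ G.XHat = RingHom.ker G.param := by
  rw [hT.XHat_eq]
  ext f
  rw [mem_vanishingIdeal_iff, RingHom.mem_ker]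
  constructor
  · intro h
    refine forall_edgeWeights fun w => ?_
    rw [aeval_param]
    exact h _ ⟨w, rfl⟩
  · rintro h _ ⟨w, rfl⟩
    rw [← aeval_param, h, map_zero]

theorem IsDirectedTree.param_surjective (hT : G.IsDirectedTree) :
    Function.Surjective G.param := by
  rw [← AlgHom.range_eq_top, eq_top_iff, ← MvPolynomial.adjoin_range_X, Algebra.adjoin_le_iff]
  rintro _ ⟨e, rfl⟩
  refine ⟨X s(e.1.1, e.1.2), ?_⟩
  change G.param _ = _
  rw [param, aeval_X, trekPoint_mk, hT.trek_of_edge _ e.2, G.edgeVar_of_edge e.2]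

theorem IsDirectedTree.isSmoothVariety_XHat (hT : G.IsDirectedTree) :
    IsSmoothVariety G.XHat := by
  classical
  rw [IsSmoothVariety, hT.vanishingIdeal_XHat]
  have : Algebra.Smooth ℂ (MvPolynomial G.EdgeSet ℂ) := {}
  exact Algebra.Smooth.of_equiv
    (Ideal.quotientKerAlgEquivOfSurjective hT.param_surjective).symm

theorem IsDirectedTree.isPrime_imposedIdealHat (hT : G.IsDirectedTree) :
    G.imposedIdealHat.IsPrime := by
  rw [hT.imposedIdealHat_eq_ker]
  exact RingHom.ker_isPrime _

/-- Zero weights give the identity matrix, where every principal minor is one. -/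
theorem IsDirectedTree.thetaHat_notMem (hT : G.IsDirectedTree) :
    thetaHat n ∉ G.imposedIdealHat := by
  intro h
  rw [hT.imposedIdealHat_eq_ker] at h
  have h0 : aeval (offDiagCoord (G.trekPoint fun _ _ => (0 : ℂ))) (thetaHat n) = 0 := by
    rw [← aeval_paramHat, show G.paramHat (thetaHat n) = 0 from h, map_zero]
  have hM : (genericMatrixHat n).map
      (aeval (R := ℂ) (offDiagCoord (G.trekPoint fun _ _ => (0 : ℂ)))) = 1 := by
    refine (map_genericMatrixHat_of_trek _).trans ?_
    ext i j
    rw [Matrix.of_apply, trek_zero, Matrix.one_apply]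
  rw [thetaHat, map_prod, Finset.prod_eq_one] at h0
  · exact one_ne_zero h0
  · intro A _
    rw [AlgHom.map_det, AlgHom.mapMatrix_apply, ← Matrix.submatrix_map, hM,
      Matrix.submatrix_one _ Subtype.val_injective, Matrix.det_one]

theorem saturation_eq_self {R : Type} [CommRing R] {I : Ideal R} (hI : I.IsPrime) {θ : R}
    (hθ : θ ∉ I) : saturation I θ = I := by
  refine IsLocalization.under_map_of_isPrime_disjoint (Submonoid.powers θ) _ hI ?_
  rw [Set.disjoint_left]
  rintro _ ⟨k, rfl⟩ hk
  exact hθ (hI.mem_of_pow_mem k hk)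

end Varieties

end DAGModel

theorem mainTheorem8 (n : ℕ) (T : DAGModel n) (hT : T.IsDirectedTree) :
    T.imposedIdealHat.IsPrime ∧
    T.imposedIdealHat = DAGModel.idealHat T.XHat ∧
    DAGModel.saturation T.imposedIdealHat (DAGModel.thetaHat n) = T.imposedIdealHat ∧
    MvPolynomial.zeroLocus ℂ T.imposedIdeal ∩ DAGModel.sigHat n =
      DAGModel.zariskiClosure (T.loc ∩ DAGModel.sigHat n) ∧
    DAGModel.IsSmoothVariety T.XHat :=
  ⟨hT.isPrime_imposedIdealHat, hT.imposedIdealHat_eq_ker.trans hT.idealHat_XHat.symm,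
    DAGModel.saturation_eq_self hT.isPrime_imposedIdealHat hT.thetaHat_notMem,
    hT.zeroLocus_inter_sigHat.trans hT.XHat_eq.symm, hT.isSmoothVariety_XHat⟩
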